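/- A \emph{mesh} $M$ is a plane straight-line graph with a finite set of vertices such that all bounded faces are triangles, the interiors of distinct triangles are disjoint, and any two distinct triangles that meet do so in a common vertex or a common edge. Its \emph{size} is its number $n$ of vertices. For $\delta>0$, the mesh is \emph{$\delta$-fat} if every angle of every triangle of $M$ is at least $\delta$; for a constant $\rho$, it is \emph{$\rho$-compact} if the lengths of any two edges of $M$ differ by a factor of at most $\rho$. A convex polygon $P$ (a compact convex region with nonempty interior) \emph{respects} $M$ if its boundary is a union of edges of $M$ (consecutive boundary edges may be collinear), and it is \emph{outerplanar} (with respect to $M$) if no vertex of $M$ lies in the interior of $P$. \textbf{Theorem.} For every $\delta>0$ and every $\rho$ there is a constant $C$, depending only on $\delta$ and $\rho$, such that every $\delta$-fat, $\rho$-compact mesh $M$ of size $n$ has at most $C n^2$ convex outerplanar polygons that respect $M$. -/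

import Mathlib

/-- The Euclidean plane. -/
abbrev EPlane : Type := EuclideanSpace ℝ (Fin 2)

/-- A plane straight-line graph with finitely many vertices: the vertices are points of the
plane, the edges are drawn as segments, two different edges meet at most in common endpoints, and
an edge contains no vertices besides its endpoints. -/
structure PlaneStraightLineGraph where
  verts : Finset EPlane
  graph : SimpleGraph EPlane
  mem_verts : ∀ {p q : EPlane}, graph.Adj p q → p ∈ verts
  edge_inter_edge : ∀ {p q r s : EPlane}, graph.Adj p q → graph.Adj r s → s(p, q) ≠ s(r, s) →
    segment ℝ p q ∩ segment ℝ r s ⊆ {p, q} ∩ {r, s}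
  vertex_on_edge : ∀ {p q v : EPlane}, graph.Adj p q → v ∈ verts → v ∈ segment ℝ p q →
    v = p ∨ v = q

namespace PlaneStraightLineGraph

/-- The size of the graph is its number of vertices. -/
def size (M : PlaneStraightLineGraph) : ℕ := M.verts.card

/-- The subset of the plane covered by the vertices and edges. -/
def drawing (M : PlaneStraightLineGraph) : Set EPlane :=
  {x | x ∈ M.verts ∨ ∃ p q : EPlane, M.graph.Adj p q ∧ x ∈ segment ℝ p q}

/-- The faces are the connected components of the complement of the drawing. -/
def IsFace (M : PlaneStraightLineGraph) (F : Set EPlane) : Prop :=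
  ∃ x ∈ M.drawingᶜ, F = connectedComponentIn M.drawingᶜ x

/-- `a`, `b`, `c` are the corners (in any order) of a triangle of `M`: they are pairwise joined by
edges, and the open triangle they span is a face. -/
def IsTriangle (M : PlaneStraightLineGraph) (a b c : EPlane) : Prop :=
  M.graph.Adj a b ∧ M.graph.Adj b c ∧ M.graph.Adj a c ∧
    M.IsFace (interior (convexHull ℝ {a, b, c}))

/-- A mesh: all bounded faces are triangles, the interiors of distinct triangles are disjoint, and
two distinct triangles that meet do so in a common vertex or in a common edge. -/
structure IsMesh (M : PlaneStraightLineGraph) : Prop where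
  bounded_face : ∀ F : Set EPlane, M.IsFace F → Bornology.IsBounded F →
    ∃ a b c : EPlane, M.IsTriangle a b c ∧ F = interior (convexHull ℝ {a, b, c})
  disjoint_interior : ∀ a b c a' b' c' : EPlane, M.IsTriangle a b c → M.IsTriangle a' b' c' →
    ({a, b, c} : Set EPlane) ≠ {a', b', c'} →
    Disjoint (interior (convexHull ℝ {a, b, c})) (interior (convexHull ℝ {a', b', c'}))
  triangle_inter : ∀ a b c a' b' c' : EPlane, M.IsTriangle a b c → M.IsTriangle a' b' c' →
    ({a, b, c} : Set EPlane) ≠ {a', b', c'} →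
    convexHull ℝ {a, b, c} ∩ convexHull ℝ {a', b', c'} = ∅ ∨
    (∃ v : EPlane, v ∈ ({a, b, c} : Set EPlane) ∩ {a', b', c'} ∧
      convexHull ℝ {a, b, c} ∩ convexHull ℝ {a', b', c'} = {v}) ∨
    (∃ v w : EPlane, v ≠ w ∧ v ∈ ({a, b, c} : Set EPlane) ∩ {a', b', c'} ∧
      w ∈ ({a, b, c} : Set EPlane) ∩ {a', b', c'} ∧
      convexHull ℝ {a, b, c} ∩ convexHull ℝ {a', b', c'} = segment ℝ v w)

/-- `δ`-fatness: every angle of every triangle is at least `δ`. (All three angles are covered, since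
`IsTriangle` does not depend on the order of the corners.) -/
def IsFat (M : PlaneStraightLineGraph) (δ : ℝ) : Prop :=
  ∀ a b c : EPlane, M.IsTriangle a b c → δ ≤ EuclideanGeometry.angle a b c

/-- Compactness: any two edges differ in length by a factor of at most `ρ`. -/
def HasEdgeRatio (M : PlaneStraightLineGraph) (ρ : ℝ) : Prop :=
  ∀ p q r s : EPlane, M.graph.Adj p q → M.graph.Adj r s → dist p q ≤ ρ * dist r s

/-- A convex polygon (as a region) that respects `M`: a compact convex set with nonempty interior
whose boundary is a union of edges of `M`. Consecutive collinear boundary edges are allowed. -/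
structure IsConvexPolygon (M : PlaneStraightLineGraph) (P : Set EPlane) : Prop where
  isCompact : IsCompact P
  convex : Convex ℝ P
  nonempty_interior : (interior P).Nonempty
  respects : ∀ x ∈ frontier P, ∃ p q : EPlane, M.graph.Adj p q ∧ x ∈ segment ℝ p q ∧
    segment ℝ p q ⊆ frontier P

/-- A carrot: a convex polygon that respects `M` and is outerplanar, that is, contains no vertex of
`M` in its interior. -/
structure IsCarrot (M : PlaneStraightLineGraph) (P : Set EPlane) : Prop
    extends M.IsConvexPolygon P where
  outerplanar : ∀ v ∈ M.verts, v ∉ interior P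

end PlaneStraightLineGraph

/-!
A carrot is determined by its two ends. Let `L` bound the edge lengths of the mesh, and let `a`, `b`
be mesh vertices in the carrot `P` at the largest distance from each other (`IsEndPair`). There are
`n ^ 2` choices of `(a, b)`. Given `(a, b)`, the carrot is determined by the set of mesh triangles
that it contains within distance `12 L / sin δ + L` of `a` or `b`
(`IsCarrot.eq_of_trianglesNear_eq`). As triangles have disjoint interiors and each contains a disc
of radius comparable to `L`, only boundedly many lie near `a` or `b`
(`ncard_le_of_disjoint_interior`), so each pair `(a, b)` belongs to boundedly many carrots.

For the uniqueness, let `P` and `Q` be carrots with the same ends and the same triangles near them,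
and suppose that `Q` is not contained in `P`. Some triangle `pqr` of `Q` is then attached from the
outside to a boundary edge `pq` of `P` that crosses the interior of `Q`
(`exists_attached_triangle`). The vertex `p` is on the boundary of `Q`, since `Q` is outerplanar, so
`P ∩ Q` lies in the cone at `p` left over by the angle `rpq ≥ δ` in a half-plane, and `a` and `b`
are seen from `p` under an angle of at most `π - δ` (`inner_ge_of_attached`). The triangle `pqr`
is not in `P`, so `p` is far from `a` and `b`. As `ab` is the longest side of the triangle `apb`,
the angle at `p` is also at least `π / 3`; hence this triangle contains a disc of radius `2 L`, and
therefore a mesh vertex in the interior of `P` (`IsCarrot.inner_lt_of_far`), a contradiction.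

Angles are handled through inner products and the determinant `cross`, and the position of points
relative to lines through separating functionals.
-/

/-! ### Vectors in the plane -/

/-- The cross product (determinant) of two plane vectors. -/
def cross (A B : EPlane) : ℝ := A 0 * B 1 - A 1 * B 0

theorem inner_eq_coord (A B : EPlane) : inner ℝ A B = A 0 * B 0 + A 1 * B 1 := by
  simp [PiLp.inner_apply, Fin.sum_univ_two, mul_comm]

theorem norm_sq_eq_coord (A : EPlane) : ‖A‖ ^ 2 = A 0 ^ 2 + A 1 ^ 2 := by
  rw [← real_inner_self_eq_norm_sq, inner_eq_coord]; ring

theorem cross_sq_add_inner_sq (A B : EPlane) :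
    cross A B ^ 2 + inner ℝ A B ^ 2 = ‖A‖ ^ 2 * ‖B‖ ^ 2 := by
  rw [inner_eq_coord, norm_sq_eq_coord, norm_sq_eq_coord, cross]; ring

theorem abs_cross_le (A B : EPlane) : |cross A B| ≤ ‖A‖ * ‖B‖ := by
  apply abs_le_of_sq_le_sq _ (by positivity)
  nlinarith [cross_sq_add_inner_sq A B, sq_nonneg (inner ℝ A B : ℝ)]

/-- Cramer's rule in the plane. -/
theorem eq_combo_of_cross_ne_zero {w u : EPlane} (h : cross w u ≠ 0) (A : EPlane) :
    A = (cross A u / cross w u) • w + (cross w A / cross w u) • u := by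
  ext i
  simp only [PiLp.add_apply, PiLp.smul_apply, smul_eq_mul]
  field_simp
  fin_cases i <;> simp only [cross, Fin.zero_eta, Fin.mk_one] <;> ring

theorem sin_mul_le_abs_cross {A B : EPlane} {δ : ℝ}
    (h : |inner ℝ A B| ≤ Real.cos δ * (‖A‖ * ‖B‖)) :
    Real.sin δ * (‖A‖ * ‖B‖) ≤ |cross A B| := by
  have h2 : (inner ℝ A B : ℝ) ^ 2 ≤ (Real.cos δ * (‖A‖ * ‖B‖)) ^ 2 := sq_le_sq' (by
    linarith [neg_abs_le (inner ℝ A B : ℝ)]) (by linarith [le_abs_self (inner ℝ A B : ℝ)])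
  refine le_of_abs_le (sq_le_sq.mp ?_)
  nlinarith [cross_sq_add_inner_sq A B, Real.sin_sq_add_cos_sq δ]

/-- A lower bound for the inner product of two vectors `s₁ w + t₁ v`, `s₂ w + t₂ v` of a convex
cone (here `k` is the inner product of `w` and `v`, and `W`, `V` are their lengths). -/
theorem mul_sub_le_inner_combo {W V k s₁ t₁ s₂ t₂ : ℝ} (hk : k ^ 2 ≤ W ^ 2 * V ^ 2)
    (hs₁ : 0 ≤ s₁) (ht₁ : 0 ≤ t₁) (hs₂ : 0 ≤ s₂) (ht₂ : 0 ≤ t₂) (hD : s₂ * t₁ ≤ s₁ * t₂) :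
    k * (s₁ * t₂ - s₂ * t₁) ≤ s₁ * s₂ * W ^ 2 + t₁ * t₂ * V ^ 2 + k * (s₁ * t₂ + s₂ * t₁) := by
  have h0 : 0 ≤ s₂ * t₁ := by positivity
  have h1 : (2 * (s₂ * t₁) * k) ^ 2 ≤ (s₁ * s₂ * W ^ 2 + t₁ * t₂ * V ^ 2) ^ 2 := by
    calc (2 * (s₂ * t₁) * k) ^ 2 = 4 * ((s₂ * t₁) * (s₂ * t₁)) * k ^ 2 := by ring
      _ ≤ 4 * ((s₂ * t₁) * (s₁ * t₂)) * (W ^ 2 * V ^ 2) := by gcongr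
      _ = 4 * (s₁ * s₂ * W ^ 2) * (t₁ * t₂ * V ^ 2) := by ring
      _ ≤ _ := by nlinarith [sq_nonneg (s₁ * s₂ * W ^ 2 - t₁ * t₂ * V ^ 2)]
  have h2 := (abs_le.mp (abs_le_of_sq_le_sq h1 (by positivity))).1
  linarith

/-- Two vectors of the convex cone spanned by `w` and `v` make an angle no larger than that of
`w` and `v`, expressed through a lower bound `-c ≤ 0` for the cosine. -/
theorem inner_cone_ge {w v : EPlane} {c s₁ t₁ s₂ t₂ : ℝ} (hc : 0 ≤ c)
    (h : -c * (‖w‖ * ‖v‖) ≤ inner ℝ w v)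
    (hs₁ : 0 ≤ s₁) (ht₁ : 0 ≤ t₁) (hs₂ : 0 ≤ s₂) (ht₂ : 0 ≤ t₂) :
    -c * (‖s₁ • w + t₁ • v‖ * ‖s₂ • w + t₂ • v‖) ≤ inner ℝ (s₁ • w + t₁ • v) (s₂ • w + t₂ • v) := by
  set X := s₁ • w + t₁ • v with hX
  set Y := s₂ • w + t₂ • v with hY
  set k : ℝ := inner ℝ w v with hk
  rcases le_or_gt 0 (inner ℝ X Y : ℝ) with hI | hI
  · have : 0 ≤ c * (‖X‖ * ‖Y‖) := by positivity
    linarith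
  have inner_eq : ∀ a b a' b' : ℝ, (inner ℝ (a • w + b • v) (a' • w + b' • v) : ℝ) =
      a * a' * ‖w‖ ^ 2 + b * b' * ‖v‖ ^ 2 + k * (a * b' + a' * b) := by
    intro a b a' b'
    simp only [inner_add_left, inner_add_right, real_inner_smul_left, real_inner_smul_right,
      real_inner_self_eq_norm_sq, real_inner_comm w v, ← hk]
    ring
  have hXY := inner_eq s₁ t₁ s₂ t₂
  rw [← hX, ← hY] at hXY
  have hXX := inner_eq s₁ t₁ s₁ t₁
  have hYY := inner_eq s₂ t₂ s₂ t₂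
  rw [← hX, real_inner_self_eq_norm_sq] at hXX
  rw [← hY, real_inner_self_eq_norm_sq] at hYY
  have hk0 : k < 0 := by
    by_contra hk0
    have : 0 ≤ k * (s₁ * t₂ + s₂ * t₁) := mul_nonneg (not_lt.mp hk0) (by positivity)
    have : 0 ≤ s₁ * s₂ * ‖w‖ ^ 2 + t₁ * t₂ * ‖v‖ ^ 2 := by positivity
    linarith
  have hkk : k ^ 2 ≤ ‖w‖ ^ 2 * ‖v‖ ^ 2 := by
    nlinarith [cross_sq_add_inner_sq w v, sq_nonneg (cross w v)]
  have hWV : 0 < ‖w‖ ^ 2 * ‖v‖ ^ 2 := lt_of_lt_of_le (sq_pos_of_ne_zero hk0.ne) hkk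
  -- the coordinate determinant dominates the inner product
  have hID : (inner ℝ X Y : ℝ) ^ 2 ≤ (k * (s₁ * t₂ - s₂ * t₁)) ^ 2 := by
    rcases le_total (s₂ * t₁) (s₁ * t₂) with hD | hD
    · have := mul_sub_le_inner_combo hkk hs₁ ht₁ hs₂ ht₂ hD
      nlinarith
    · have := mul_sub_le_inner_combo hkk hs₂ ht₂ hs₁ ht₁ hD
      nlinarith
  have hgram : ‖X‖ ^ 2 * ‖Y‖ ^ 2 - (inner ℝ X Y : ℝ) ^ 2 =
      (‖w‖ ^ 2 * ‖v‖ ^ 2 - k ^ 2) * (s₁ * t₂ - s₂ * t₁) ^ 2 := by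
    rw [hXY, hXX, hYY]; ring
  have h1 : (inner ℝ X Y : ℝ) ^ 2 * (‖w‖ ^ 2 * ‖v‖ ^ 2) ≤ k ^ 2 * (‖X‖ ^ 2 * ‖Y‖ ^ 2) := by
    have : 0 ≤ (‖w‖ ^ 2 * ‖v‖ ^ 2 - k ^ 2) *
        ((k * (s₁ * t₂ - s₂ * t₁)) ^ 2 - (inner ℝ X Y : ℝ) ^ 2) :=
      mul_nonneg (by linarith) (by linarith)
    linear_combination this - k ^ 2 * hgram
  have h2 : k ^ 2 ≤ c ^ 2 * (‖w‖ ^ 2 * ‖v‖ ^ 2) := by nlinarith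
  have h3 : (inner ℝ X Y : ℝ) ^ 2 ≤ (c * (‖X‖ * ‖Y‖)) ^ 2 := by
    refine le_of_mul_le_mul_right (h1.trans ?_) hWV
    calc k ^ 2 * (‖X‖ ^ 2 * ‖Y‖ ^ 2) ≤ c ^ 2 * (‖w‖ ^ 2 * ‖v‖ ^ 2) * (‖X‖ ^ 2 * ‖Y‖ ^ 2) := by
          gcongr
      _ = _ := by ring
  have := (abs_le.mp (abs_le_of_sq_le_sq h3 (by positivity))).1
  linarith

theorem mem_convexHull_triple {a b c x : EPlane} : x ∈ convexHull ℝ {a, b, c} ↔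
    ∃ α β γ : ℝ, 0 ≤ α ∧ 0 ≤ β ∧ 0 ≤ γ ∧ α + β + γ = 1 ∧ α • a + β • b + γ • c = x := by
  constructor
  · intro hx
    rw [convexHull_insert (by simp), convexHull_pair, mem_convexJoin] at hx
    obtain ⟨y, hy, z, hz, hx⟩ := hx
    rw [Set.mem_singleton_iff] at hy
    subst hy
    obtain ⟨s, t, hs, ht, hst, rfl⟩ := hz
    obtain ⟨s', t', hs', ht', hst', rfl⟩ := hx
    refine ⟨s', t' * s, t' * t, hs', by positivity, by positivity, ?_, by module⟩
    rw [add_assoc, ← mul_add, hst, mul_one, hst']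
  · rintro ⟨α, β, γ, hα, hβ, hγ, hsum, rfl⟩
    have hsub := subset_convexHull ℝ ({a, b, c} : Set EPlane)
    have := (convex_convexHull ℝ ({a, b, c} : Set EPlane)).sum_mem (t := Finset.univ)
      (w := ![α, β, γ]) (z := ![a, b, c]) (by intro i _; fin_cases i <;> simpa)
      (by simpa [Fin.sum_univ_three]) (by intro i _; fin_cases i <;> exact hsub (by simp))
    simpa [Fin.sum_univ_three] using this

/-- A triangle spanned at `p` by two vectors of length at least `R`, whose angle has sine at least
`κ`, contains the ball of radius `κ R / 6` around its centroid. -/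
theorem ball_centroid_subset {p A B : EPlane} {κ R : ℝ} (hκ : 0 < κ) (hR : 0 < R)
    (hA : R ≤ ‖A‖) (hB : R ≤ ‖B‖) (h : κ * (‖A‖ * ‖B‖) ≤ |cross A B|) :
    Metric.ball (p + (3⁻¹ : ℝ) • (A + B)) (κ * R / 6) ⊆ convexHull ℝ {p, p + A, p + B} := by
  intro x hx
  rw [Metric.mem_ball, dist_eq_norm] at hx
  set e := x - (p + (3⁻¹ : ℝ) • (A + B)) with he
  have hA0 : 0 < ‖A‖ := hR.trans_le hA
  have hB0 : 0 < ‖B‖ := hR.trans_le hB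
  have hD : 0 < |cross A B| := lt_of_lt_of_le (by positivity) h
  have hne : cross A B ≠ 0 := abs_pos.mp hD
  have key : ∀ z : ℝ, |z| ≤ ‖e‖ * ‖A‖ ∨ |z| ≤ ‖e‖ * ‖B‖ → |z / cross A B| < 1 / 6 := by
    intro z hz
    rw [abs_div, div_lt_iff₀ hD]
    rcases hz with hz | hz
    · calc |z| ≤ ‖e‖ * ‖A‖ := hz
        _ < κ * R / 6 * ‖A‖ := by gcongr
        _ ≤ κ * ‖B‖ / 6 * ‖A‖ := by gcongr
        _ ≤ _ := by linarith
    · calc |z| ≤ ‖e‖ * ‖B‖ := hz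
        _ < κ * R / 6 * ‖B‖ := by gcongr
        _ ≤ κ * ‖A‖ / 6 * ‖B‖ := by gcongr
        _ ≤ _ := by linarith
  have h1 := abs_lt.mp (key (cross e B) (Or.inr (abs_cross_le e B)))
  have h2 := abs_lt.mp (key (cross A e) (Or.inl ((abs_cross_le A e).trans_eq (mul_comm _ _))))
  have hx' : x = (1 - (3⁻¹ + cross e B / cross A B) - (3⁻¹ + cross A e / cross A B)) • p +
      (3⁻¹ + cross e B / cross A B) • (p + A) + (3⁻¹ + cross A e / cross A B) • (p + B) := by
    have : x = p + (3⁻¹ : ℝ) • (A + B) + e := by rw [he]; abel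
    rw [this]
    conv_lhs => rw [eq_combo_of_cross_ne_zero hne e]
    module
  exact mem_convexHull_triple.mpr
    ⟨_, _, _, by linarith, by linarith, by linarith, by ring, hx'.symm⟩

/-! ### Convex sets and their supporting functionals -/

theorem exists_support {K : Set EPlane} (hK : Convex ℝ K) (hne : (interior K).Nonempty)
    {x : EPlane} (hx : x ∉ interior K) :
    ∃ f : StrongDual ℝ EPlane, (∀ y ∈ interior K, f y < f x) ∧ ∀ y ∈ K, f y ≤ f x := by
  obtain ⟨f, hf⟩ := geometric_hahn_banach_open_point hK.interior isOpen_interior hx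
  refine ⟨f, hf, fun y hy => ?_⟩
  have hcl : y ∈ closure (interior K) := by
    rw [hK.closure_interior_eq_closure_of_nonempty_interior hne]
    exact subset_closure hy
  exact closure_minimal (fun z hz => (hf z hz).le)
    (isClosed_le f.continuous continuous_const) hcl

theorem IsPreconnected.subset_interior_of_disjoint_frontier {F P : Set EPlane}
    (hF : IsPreconnected F) (hd : Disjoint F (frontier P)) (hm : (F ∩ P).Nonempty) :
    F ⊆ interior P := by
  have hcov : F ⊆ interior P ∪ (closure P)ᶜ := by
    intro y hy
    by_contra hc
    simp only [Set.mem_union, not_or, Set.mem_compl_iff, not_not] at hc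
    exact Set.disjoint_left.mp hd hy ⟨hc.2, hc.1⟩
  refine IsPreconnected.subset_left_of_subset_union isOpen_interior isClosed_closure.isOpen_compl
    (Set.disjoint_left.mpr fun y hy hy' => hy' (subset_closure (interior_subset hy))) hcov ?_ hF
  obtain ⟨y, hyF, hyP⟩ := hm
  rcases hcov hyF with h | h
  · exact ⟨y, hyF, h⟩
  · exact absurd (subset_closure hyP) h

/-- A point of a nondegenerate triangle that is not interior lies on one of the sides. -/
theorem mem_side_of_notMem_interior {a b c x : EPlane}
    (hne : (interior (convexHull ℝ {a, b, c})).Nonempty) (hx : x ∈ convexHull ℝ {a, b, c})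
    (hxi : x ∉ interior (convexHull ℝ {a, b, c})) :
    x ∈ segment ℝ a b ∨ x ∈ segment ℝ b c ∨ x ∈ segment ℝ a c := by
  obtain ⟨f, hf, hf'⟩ := exists_support (convex_convexHull ℝ _) hne hxi
  have hsub := subset_convexHull ℝ ({a, b, c} : Set EPlane)
  have ha := hf' a (hsub (by simp))
  have hb := hf' b (hsub (by simp))
  have hc := hf' c (hsub (by simp))
  obtain ⟨α, β, γ, hα, hβ, hγ, hsum, hcomb⟩ := mem_convexHull_triple.mp hx
  rcases hα.eq_or_lt with h | hα'
  · subst h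
    exact Or.inr (Or.inl ⟨β, γ, hβ, hγ, by linarith, by simpa using hcomb⟩)
  rcases hβ.eq_or_lt with h | hβ'
  · subst h
    exact Or.inr (Or.inr ⟨α, γ, hα, hγ, by linarith, by simpa using hcomb⟩)
  rcases hγ.eq_or_lt with h | hγ'
  · subst h
    exact Or.inl ⟨α, β, hα, hβ, by linarith, by simpa using hcomb⟩
  -- with three positive weights the supporting functional is constant on the triangle
  exfalso
  have hfx : f x = α * f a + β * f b + γ * f c := by rw [← hcomb]; simp
  have h0 : α * (f x - f a) + β * (f x - f b) + γ * (f x - f c) = 0 := by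
    rw [show α * (f x - f a) + β * (f x - f b) + γ * (f x - f c) =
      (α + β + γ) * f x - (α * f a + β * f b + γ * f c) by ring, hsum, ← hfx]; ring
  have h1 : 0 ≤ α * (f x - f a) := mul_nonneg hα (by linarith)
  have h2 : 0 ≤ β * (f x - f b) := mul_nonneg hβ (by linarith)
  have h3 : 0 ≤ γ * (f x - f c) := mul_nonneg hγ (by linarith)
  have ea : f a = f x := by nlinarith
  have eb : f b = f x := by nlinarith
  have ec : f c = f x := by nlinarith
  obtain ⟨y, hy⟩ := hne
  obtain ⟨α', β', γ', -, -, -, hsum', hy'⟩ := mem_convexHull_triple.mp (interior_subset hy)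
  have hlt := hf y hy
  rw [← hy'] at hlt
  simp only [map_add, map_smul, smul_eq_mul, ea, eb, ec] at hlt
  rw [← add_mul, ← add_mul, hsum', one_mul] at hlt
  exact lt_irrefl _ hlt

theorem volume_segment (p q : EPlane) : MeasureTheory.volume (segment ℝ p q) = 0 := by
  refine MeasureTheory.measure_mono_null (t := (line[ℝ, p, q] : Set EPlane)) ?_ ?_
  · rw [← convexHull_pair]
    exact convexHull_subset_affineSpan _
  · apply MeasureTheory.Measure.addHaar_affineSubspace
    intro htop
    have h1 := collinear_pair ℝ p q
    rw [collinear_iff_finrank_le_one, ← direction_affineSpan, htop,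
      AffineSubspace.direction_top, finrank_top] at h1
    simp at h1

namespace PlaneStraightLineGraph

variable {M : PlaneStraightLineGraph} {P Q : Set EPlane} {a b c p q r : EPlane} {δ ρ : ℝ}

/-! ### Faces and triangles of a mesh -/

theorem mem_verts_right (h : M.graph.Adj p q) : q ∈ M.verts := M.mem_verts h.symm

theorem IsTriangle.swap₁₂ (h : M.IsTriangle a b c) : M.IsTriangle b a c :=
  ⟨h.1.symm, h.2.2.1, h.2.1, by rw [Set.insert_comm]; exact h.2.2.2⟩

theorem IsTriangle.swap₂₃ (h : M.IsTriangle a b c) : M.IsTriangle a c b :=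
  ⟨h.2.2.1, h.2.1.symm, h.1, by rw [Set.pair_comm]; exact h.2.2.2⟩

theorem drawing_eq : M.drawing = (M.verts : Set EPlane) ∪
    ⋃ e ∈ {e : EPlane × EPlane | M.graph.Adj e.1 e.2}, segment ℝ e.1 e.2 := by
  ext x
  simp [drawing]

theorem finite_adj : {e : EPlane × EPlane | M.graph.Adj e.1 e.2}.Finite :=
  ((M.verts.finite_toSet).prod (M.verts.finite_toSet)).subset
    fun _ he => ⟨M.mem_verts he, mem_verts_right he⟩

theorem dense_compl_drawing : Dense M.drawingᶜ := by
  have h0 : MeasureTheory.volume M.drawing = 0 := by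
    rw [drawing_eq, MeasureTheory.measure_union_null_iff]
    exact ⟨M.verts.finite_toSet.measure_zero _,
      (MeasureTheory.measure_biUnion_null_iff finite_adj.countable).mpr
        fun e _ => volume_segment _ _⟩
  exact MeasureTheory.Measure.dense_of_ae (μ := MeasureTheory.volume)
    (p := fun x => x ∈ M.drawingᶜ) (by rw [MeasureTheory.ae_iff]; simpa using h0)

theorem IsFace.isPreconnected {F : Set EPlane} (hF : M.IsFace F) : IsPreconnected F := by
  obtain ⟨x, -, rfl⟩ := hF
  exact isPreconnected_connectedComponentIn

theorem IsFace.subset_compl {F : Set EPlane} (hF : M.IsFace F) : F ⊆ M.drawingᶜ := by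
  obtain ⟨x, -, rfl⟩ := hF
  exact connectedComponentIn_subset _ _

theorem IsFace.nonempty {F : Set EPlane} (hF : M.IsFace F) : F.Nonempty := by
  obtain ⟨x, hx, rfl⟩ := hF
  exact ⟨x, mem_connectedComponentIn hx⟩

theorem IsTriangle.interior_nonempty (h : M.IsTriangle a b c) :
    (interior (convexHull ℝ {a, b, c})).Nonempty := h.2.2.2.nonempty

/-- The union of the closed triangles of a mesh with a given property is closed. -/
theorem isClosed_iUnion_triangle (p : Set EPlane → Prop) :
    IsClosed {x | ∃ a b c, M.IsTriangle a b c ∧ p (convexHull ℝ {a, b, c}) ∧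
      x ∈ convexHull ℝ {a, b, c}} := by
  have hfin : {t : EPlane × EPlane × EPlane | M.IsTriangle t.1 t.2.1 t.2.2 ∧
      p (convexHull ℝ {t.1, t.2.1, t.2.2})}.Finite :=
    ((M.verts.finite_toSet).prod ((M.verts.finite_toSet).prod (M.verts.finite_toSet))).subset
      fun _ ht => ⟨M.mem_verts ht.1.1, M.mem_verts ht.1.2.1, mem_verts_right ht.1.2.1⟩
  have := hfin.isClosed_biUnion (f := fun t => convexHull ℝ {t.1, t.2.1, t.2.2})
    fun t _ => ((Set.toFinite _).isCompact_convexHull ℝ).isClosed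
  convert this using 1
  ext x
  simp [and_assoc]

/-! ### Triangles inside a convex polygon -/

theorem IsConvexPolygon.frontier_subset_drawing (hP : M.IsConvexPolygon P) :
    frontier P ⊆ M.drawing := by
  intro x hx
  obtain ⟨p, q, h, hxs, -⟩ := hP.respects x hx
  exact Or.inr ⟨p, q, h, hxs⟩

theorem IsConvexPolygon.subset_closure_interior (hP : M.IsConvexPolygon P) :
    P ⊆ closure (interior P) := by
  rw [hP.convex.closure_interior_eq_closure_of_nonempty_interior hP.nonempty_interior]
  exact subset_closure

theorem IsConvexPolygon.face_subset (hP : M.IsConvexPolygon P) {F : Set EPlane}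
    (hF : M.IsFace F) (hm : (F ∩ P).Nonempty) : F ⊆ interior P :=
  hF.isPreconnected.subset_interior_of_disjoint_frontier
    (Set.disjoint_left.mpr fun _ hx hx' => hF.subset_compl hx (hP.frontier_subset_drawing hx')) hm

/-- A triangle of the mesh whose interior meets a respecting convex polygon lies in it. -/
theorem IsConvexPolygon.triangle_subset (hP : M.IsConvexPolygon P) (h : M.IsTriangle a b c)
    (hm : (interior (convexHull ℝ {a, b, c}) ∩ P).Nonempty) : convexHull ℝ {a, b, c} ⊆ P := by
  have h1 := hP.face_subset h.2.2.2 hm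
  have h2 : convexHull ℝ {a, b, c} ⊆ closure (interior (convexHull ℝ {a, b, c})) := by
    rw [(convex_convexHull ℝ _).closure_interior_eq_closure_of_nonempty_interior
      h.interior_nonempty]
    exact subset_closure
  exact h2.trans (closure_minimal (h1.trans interior_subset) hP.isCompact.isClosed)

/-- A point off the drawing that lies in a respecting convex polygon lies in a triangle of the mesh
contained in the polygon. -/
theorem IsConvexPolygon.exists_triangle_of_notMem_drawing (hM : M.IsMesh)
    (hP : M.IsConvexPolygon P) {x : EPlane} (hx : x ∈ P) (hxd : x ∉ M.drawing) :
    ∃ a b c, M.IsTriangle a b c ∧ convexHull ℝ {a, b, c} ⊆ P ∧ x ∈ convexHull ℝ {a, b, c} := by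
  have hF : M.IsFace (connectedComponentIn M.drawingᶜ x) := ⟨x, hxd, rfl⟩
  have hxF : x ∈ connectedComponentIn M.drawingᶜ x := mem_connectedComponentIn hxd
  have hsub := (hP.face_subset hF ⟨x, hxF, hx⟩).trans interior_subset
  obtain ⟨a, b, c, ht, heq⟩ := hM.bounded_face _ hF (hP.isCompact.isBounded.subset hsub)
  rw [heq] at hxF
  exact ⟨a, b, c, ht, hP.triangle_subset ht ⟨x, hxF, hx⟩, interior_subset hxF⟩

/-- The closure of an open subset `U` of a respecting convex polygon is covered by the triangles
that lie in the polygon and meet `U`: their union is closed, and it contains the points of `U` off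
the drawing, which are dense in `U`. -/
theorem IsConvexPolygon.exists_triangle_of_mem_closure (hM : M.IsMesh) (hP : M.IsConvexPolygon P)
    {U : Set EPlane} (hU : IsOpen U) (hUP : U ⊆ P) {x : EPlane} (hx : x ∈ closure U) :
    ∃ a b c, M.IsTriangle a b c ∧ (convexHull ℝ {a, b, c} ⊆ P ∧
      (convexHull ℝ {a, b, c} ∩ U).Nonempty) ∧ x ∈ convexHull ℝ {a, b, c} := by
  have hcl := isClosed_iUnion_triangle (M := M) fun T => T ⊆ P ∧ (T ∩ U).Nonempty
  have hdense : U ⊆ closure (U ∩ M.drawingᶜ) := dense_compl_drawing.open_subset_closure_inter hU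
  refine closure_minimal ?_ hcl (closure_minimal hdense isClosed_closure hx)
  rintro y ⟨hyU, hyd⟩
  obtain ⟨a, b, c, ht, hsub, hy⟩ := hP.exists_triangle_of_notMem_drawing hM (hUP hyU) hyd
  exact ⟨a, b, c, ht, ⟨hsub, y, hy, hyU⟩, hy⟩

theorem IsConvexPolygon.exists_triangle (hM : M.IsMesh) (hP : M.IsConvexPolygon P)
    {x : EPlane} (hx : x ∈ P) :
    ∃ a b c, M.IsTriangle a b c ∧ convexHull ℝ {a, b, c} ⊆ P ∧ x ∈ convexHull ℝ {a, b, c} := by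
  obtain ⟨a, b, c, ht, ⟨h, -⟩, hxT⟩ := hP.exists_triangle_of_mem_closure hM isOpen_interior
    interior_subset (hP.subset_closure_interior hx)
  exact ⟨a, b, c, ht, h, hxT⟩

theorem IsCarrot.isConvexPolygon (hP : M.IsCarrot P) : M.IsConvexPolygon P := hP.toIsConvexPolygon

/-- If a carrot `Q` is not contained in a carrot `P` whose interior it meets, then some triangle of
`Q` is not in `P` and is attached to a boundary edge `pq` of `P` that crosses the interior of `Q`. -/
theorem exists_attached_triangle (hM : M.IsMesh) (hP : M.IsCarrot P) (hQ : M.IsCarrot Q)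
    (hPQ : (interior Q ∩ P).Nonempty) (hne : ¬ Q ⊆ P) :
    ∃ p q r, M.IsTriangle p q r ∧ convexHull ℝ {p, q, r} ⊆ Q ∧ ¬ convexHull ℝ {p, q, r} ⊆ P ∧
      p ∈ P ∧ q ∈ P ∧ ∃ x ∈ interior Q, x ∈ segment ℝ p q := by
  have hPc := hP.isCompact.isClosed
  obtain ⟨x, hxQ, hxP⟩ : (interior Q ∩ frontier P).Nonempty := by
    by_contra hcon
    rw [Set.not_nonempty_iff_eq_empty, ← Set.disjoint_iff_inter_eq_empty] at hcon
    have h1 := (hQ.convex.interior.isPreconnected).subset_interior_of_disjoint_frontier hcon hPQ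
    exact hne (hQ.isConvexPolygon.subset_closure_interior.trans
      (closure_minimal (h1.trans interior_subset) hPc))
  obtain ⟨p, q, hpq, hx, hseg⟩ := hP.respects x hxP
  have hxv : x ∉ M.verts := fun h => hQ.outerplanar x h hxQ
  have hxcl : x ∈ closure (interior Q ∩ Pᶜ) := by
    refine isOpen_interior.inter_closure ⟨hxQ, ?_⟩
    rw [frontier_eq_closure_inter_closure] at hxP
    exact hxP.2
  obtain ⟨a, b, c, ht, ⟨htQ, y, hyT, -, hyP⟩, hxT⟩ :=
    hQ.isConvexPolygon.exists_triangle_of_mem_closure hM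
      (isOpen_interior.inter hPc.isOpen_compl)
      (Set.inter_subset_left.trans interior_subset) hxcl
  have htP : ¬ convexHull ℝ {a, b, c} ⊆ P := fun h => hyP (h hyT)
  have hxi : x ∉ interior (convexHull ℝ {a, b, c}) := fun h =>
    ht.2.2.2.subset_compl h (Or.inr ⟨p, q, hpq, hx⟩)
  have hpP : p ∈ P := hPc.frontier_subset (hseg (left_mem_segment ℝ p q))
  have hqP : q ∈ P := hPc.frontier_subset (hseg (right_mem_segment ℝ p q))
  -- the side through `x` is the edge `pq`, as different edges only share vertices
  have side : ∀ u v w, M.IsTriangle u v w → ({u, v, w} : Set EPlane) = {a, b, c} →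
      x ∈ segment ℝ u v → ∃ p q r, M.IsTriangle p q r ∧ convexHull ℝ {p, q, r} ⊆ Q ∧
        ¬ convexHull ℝ {p, q, r} ⊆ P ∧ p ∈ P ∧ q ∈ P ∧ ∃ x ∈ interior Q, x ∈ segment ℝ p q := by
    intro u v w huvw hset hxuv
    rw [← hset] at htQ htP
    by_cases he : s(p, q) = s(u, v)
    · refine ⟨u, v, w, huvw, htQ, htP, ?_, ?_, x, hxQ, hxuv⟩ <;>
        rcases Sym2.eq_iff.mp he with ⟨rfl, rfl⟩ | ⟨rfl, rfl⟩ <;> assumption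
    · exfalso
      have := (M.edge_inter_edge hpq huvw.1 he ⟨hx, hxuv⟩).1
      rcases this with h | h
      · exact hxv (h ▸ M.mem_verts hpq)
      · exact hxv (h ▸ mem_verts_right hpq)
  rcases mem_side_of_notMem_interior ht.interior_nonempty hxT hxi with h | h | h
  · exact side a b c ht rfl h
  · exact side b c a ht.swap₁₂.swap₂₃ (by ext; simp; tauto) h
  · exact side a c b ht.swap₂₃ (by ext; simp; tauto) h

end PlaneStraightLineGraph

/-! ### Packing -/

/-- Sets with disjoint interiors that contain discs of radius `r` and lie in a common disc of
radius `R` are bounded in number by a function of `R / r`. -/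
theorem ncard_le_of_disjoint_interior {𝒯 : Set (Set EPlane)} {z : EPlane} {R r : ℝ} {k : ℕ}
    (hr : 0 < r) (hk : 2 * R / r ≤ k) (hball : ∀ T ∈ 𝒯, ∃ m, Metric.ball m r ⊆ interior T)
    (hsub : ∀ T ∈ 𝒯, T ⊆ Metric.closedBall z R)
    (hd : ∀ T ∈ 𝒯, ∀ T' ∈ 𝒯, T ≠ T' → Disjoint (interior T) (interior T')) :
    𝒯.Finite ∧ 𝒯.ncard ≤ (2 * k + 1) ^ 2 := by
  choose! m hm using hball
  -- the cell containing the centre `m T`, in a square grid of mesh width `r / 2`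
  let φ : Set EPlane → ℤ × ℤ := fun T =>
    (⌊(m T 0 - z 0) * (2 / r)⌋, ⌊(m T 1 - z 1) * (2 / r)⌋)
  let B : Finset (ℤ × ℤ) := Finset.Icc (-(k : ℤ)) k ×ˢ Finset.Icc (-(k : ℤ)) k
  have hBcard : B.card = (2 * k + 1) ^ 2 := by
    simp only [B, Finset.card_product, Int.card_Icc]
    rw [show ((k : ℤ) + 1 - -(k : ℤ)).toNat = 2 * k + 1 by omega]; ring
  have hmT : ∀ T ∈ 𝒯, m T ∈ interior T := fun T hT => hm T hT (Metric.mem_ball_self hr)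
  have floor_mem : ∀ t : ℝ, |t| ≤ R → ⌊t * (2 / r)⌋ ∈ Finset.Icc (-(k : ℤ)) k := by
    intro t ht
    have h1 : |t * (2 / r)| ≤ k := by
      rw [abs_mul, abs_of_pos (show 0 < 2 / r by positivity)]
      calc |t| * (2 / r) ≤ R * (2 / r) := by gcongr
        _ = 2 * R / r := by ring
        _ ≤ k := hk
    rw [abs_le] at h1
    rw [Finset.mem_Icc]
    refine ⟨Int.le_floor.mpr (by push_cast; exact h1.1), ?_⟩
    have := (Int.floor_le (t * (2 / r))).trans h1.2
    exact_mod_cast this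
  have hmaps : ∀ T ∈ 𝒯, φ T ∈ (B : Set (ℤ × ℤ)) := by
    intro T hT
    have h1 := hsub T hT (interior_subset (hmT T hT))
    rw [Metric.mem_closedBall, dist_eq_norm] at h1
    have h2 : ∀ i, |m T i - z i| ≤ R := fun i => by
      have := PiLp.norm_apply_le (m T - z) i
      rw [Real.norm_eq_abs] at this
      exact this.trans h1
    exact Finset.mem_coe.mpr (Finset.mem_product.mpr ⟨floor_mem _ (h2 0), floor_mem _ (h2 1)⟩)
  have hinj : Set.InjOn φ 𝒯 := by
    intro T hT T' hT' heq
    by_contra hne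
    have hlt : ∀ s t : ℝ, ⌊s * (2 / r)⌋ = ⌊t * (2 / r)⌋ → (s - t) ^ 2 < (r / 2) ^ 2 := by
      intro s t h
      have h1 := Int.abs_sub_lt_one_of_floor_eq_floor h
      rw [← sub_mul, abs_mul, abs_of_pos (show 0 < 2 / r by positivity)] at h1
      rw [sq_lt_sq, abs_of_pos (show 0 < r / 2 by positivity)]
      calc |s - t| = |s - t| * (2 / r) * (r / 2) := by field_simp
        _ < 1 * (r / 2) := by gcongr
        _ = r / 2 := one_mul _
    have h0 := hlt _ _ (Prod.ext_iff.mp heq).1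
    have h1 := hlt _ _ (Prod.ext_iff.mp heq).2
    rw [sub_sub_sub_cancel_right] at h0 h1
    have hball : m T ∈ Metric.ball (m T') r := by
      rw [Metric.mem_ball, dist_eq_norm]
      refine lt_of_pow_lt_pow_left₀ 2 hr.le ?_
      rw [norm_sq_eq_coord]
      simp only [PiLp.sub_apply]
      nlinarith [sq_pos_of_pos hr]
    exact Set.disjoint_left.mp (hd T hT T' hT' hne) (hmT T hT) (hm T' hT' hball)
  refine ⟨Set.Finite.of_injOn hmaps hinj B.finite_toSet, ?_⟩
  have := Set.ncard_le_ncard_of_injOn φ hmaps hinj B.finite_toSet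
  rwa [Set.ncard_coe_finset, hBcard] at this

namespace PlaneStraightLineGraph

variable {M : PlaneStraightLineGraph} {P Q : Set EPlane} {a b c p q r : EPlane} {δ ρ L : ℝ}

/-! ### Fat triangles -/

theorem IsTriangle.ne (h : M.IsTriangle a b c) : a ≠ b := h.1.ne

theorem IsTriangle.le_pi_div_three (hfat : M.IsFat δ) (h : M.IsTriangle p q r) :
    δ ≤ Real.pi / 3 := by
  have h1 := hfat _ _ _ h
  have h2 := hfat q r p h.swap₁₂.swap₂₃
  have h3 := hfat r p q h.swap₂₃.swap₁₂
  have := EuclideanGeometry.angle_add_angle_add_angle_eq_pi (p₁ := p) (p₂ := q) r h.ne.symm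
  linarith

theorem IsTriangle.abs_inner_le (hδ : 0 < δ) (hfat : M.IsFat δ) (h : M.IsTriangle p q r) :
    |inner ℝ (q - p) (r - p)| ≤ Real.cos δ * (‖q - p‖ * ‖r - p‖) := by
  have h1 := hfat _ _ _ h
  have h2 := hfat q r p h.swap₁₂.swap₂₃
  have h3 := hfat r p q h.swap₂₃.swap₁₂
  have hsum := EuclideanGeometry.angle_add_angle_add_angle_eq_pi (p₁ := p) (p₂ := q) r h.ne.symm
  have hθ : EuclideanGeometry.angle r p q = InnerProductGeometry.angle (q - p) (r - p) := by
    rw [EuclideanGeometry.angle_comm]; rfl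
  rw [hθ] at h3 hsum
  rw [← InnerProductGeometry.cos_angle_mul_norm_mul_norm, abs_mul,
    abs_of_nonneg (show 0 ≤ ‖q - p‖ * ‖r - p‖ by positivity)]
  gcongr
  rw [abs_le]
  constructor
  · rw [← Real.cos_pi_sub]
    exact Real.cos_le_cos_of_nonneg_of_le_pi (InnerProductGeometry.angle_nonneg _ _)
      (by linarith) (by linarith)
  · exact Real.cos_le_cos_of_nonneg_of_le_pi hδ.le (InnerProductGeometry.angle_le_pi _ _) h3

theorem IsTriangle.half_le_cos (hδ : 0 < δ) (hfat : M.IsFat δ) (h : M.IsTriangle p q r) :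
    1 / 2 ≤ Real.cos δ := by
  rw [← Real.cos_pi_div_three]
  exact Real.cos_le_cos_of_nonneg_of_le_pi hδ.le (by linarith [Real.pi_pos])
    (h.le_pi_div_three hfat)

theorem IsTriangle.sin_pos (hδ : 0 < δ) (hfat : M.IsFat δ) (h : M.IsTriangle p q r) :
    0 < Real.sin δ :=
  Real.sin_pos_of_pos_of_lt_pi hδ (by linarith [Real.pi_pos, h.le_pi_div_three hfat])

/-- A fat triangle whose sides have length at least `ℓ` contains a disc of radius proportional
to `ℓ`. -/
theorem IsTriangle.exists_ball_subset (hδ : 0 < δ) (hfat : M.IsFat δ) {ℓ : ℝ} (hℓ : 0 < ℓ)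
    (hedge : ∀ p q, M.graph.Adj p q → ℓ ≤ dist p q) (h : M.IsTriangle p q r) :
    ∃ m, Metric.ball m (Real.sin δ * ℓ / 6) ⊆ interior (convexHull ℝ {p, q, r}) := by
  have h1 := ball_centroid_subset (p := p) (h.sin_pos hδ hfat) hℓ
    ((hedge _ _ h.1.symm).trans_eq (dist_eq_norm q p))
    ((hedge _ _ h.2.2.1.symm).trans_eq (dist_eq_norm r p))
    (sin_mul_le_abs_cross (h.abs_inner_le hδ hfat))
  rw [add_sub_cancel, add_sub_cancel] at h1
  exact ⟨_, interior_maximal h1 Metric.isOpen_ball⟩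

theorem IsTriangle.subset_closedBall (hL : ∀ p q, M.graph.Adj p q → dist p q ≤ L)
    (h : M.IsTriangle p q r) : convexHull ℝ {p, q, r} ⊆ Metric.closedBall p L := by
  refine convexHull_min ?_ (convex_closedBall p L)
  rintro x (rfl | rfl | rfl)
  · exact Metric.mem_closedBall_self (dist_nonneg.trans (hL _ _ h.1))
  · exact hL _ _ h.1.symm
  · exact hL _ _ h.2.2.1.symm

/-! ### Carrots are thin -/

/-- Seen from a mesh vertex `p` of a carrot that is far from both `a` and `b`, where `ab` is a
longest side of the triangle `apb` in the carrot, the angle at `p` exceeds `π - δ`: otherwise the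
triangle contains a large disc, hence a vertex of the mesh in the interior of the carrot. -/
theorem IsCarrot.inner_lt_of_far (hM : M.IsMesh) (hP : M.IsCarrot P) (hL0 : 0 < L)
    (hL : ∀ p q, M.graph.Adj p q → dist p q ≤ L) (hsin : 0 < Real.sin δ)
    (hcos : 1 / 2 ≤ Real.cos δ) (ha : a ∈ P) (hb : b ∈ P) (hp : p ∈ P)
    (hpa : 12 * L / Real.sin δ ≤ dist a p) (hpb : 12 * L / Real.sin δ ≤ dist b p)
    (hab : dist p a ≤ dist a b) (hba : dist p b ≤ dist a b) :
    inner ℝ (a - p) (b - p) < -Real.cos δ * (‖a - p‖ * ‖b - p‖) := by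
  by_contra! hI
  rw [dist_eq_norm] at hpa hpb
  rw [dist_comm, dist_eq_norm, dist_eq_norm, ← sub_sub_sub_cancel_right a b p] at hab hba
  set A := a - p with hA
  set B := b - p with hB
  have hd : ‖A - B‖ ^ 2 = ‖A‖ ^ 2 - 2 * inner ℝ A B + ‖B‖ ^ 2 := norm_sub_sq_real A B
  have hR : 0 < 12 * L / Real.sin δ := by positivity
  have hhalf : (inner ℝ A B : ℝ) ≤ 1 / 2 * (‖A‖ * ‖B‖) := by
    rcases le_total ‖A‖ ‖B‖ with h | h
    · nlinarith [norm_nonneg A, norm_nonneg B, norm_nonneg (A - B)]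
    · nlinarith [norm_nonneg A, norm_nonneg B, norm_nonneg (A - B)]
  have habs : |inner ℝ A B| ≤ Real.cos δ * (‖A‖ * ‖B‖) := by
    rw [abs_le]
    refine ⟨by linarith, hhalf.trans ?_⟩
    gcongr
  have hball := ball_centroid_subset (p := p) hsin hR hpa hpb (sin_mul_le_abs_cross habs)
  rw [hA, hB, add_sub_cancel, add_sub_cancel,
    show Real.sin δ * (12 * L / Real.sin δ) / 6 = 2 * L by field_simp; norm_num] at hball
  set m := p + (3⁻¹ : ℝ) • (a - p + (b - p))
  have hsubP : convexHull ℝ {p, a, b} ⊆ P := convexHull_min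
    (by rintro x (rfl | rfl | rfl) <;> assumption) hP.convex
  have hmP : m ∈ P := hsubP (hball (Metric.mem_ball_self (by positivity)))
  obtain ⟨u, v, w, ht, -, hmT⟩ := hP.isConvexPolygon.exists_triangle hM hmP
  have hmu := ht.subset_closedBall hL hmT
  refine hP.outerplanar u (M.mem_verts ht.1)
    (interior_maximal (hball.trans hsubP) Metric.isOpen_ball ?_)
  rw [Metric.mem_closedBall, dist_comm] at hmu
  rw [Metric.mem_ball]
  linarith

/-- A triangle attached to a boundary edge `pq` of a convex set `P` forces the angle at `p` under
which two points of the intersection of `P` with a convex set `Q`, that contains the triangle and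
has `p` on its boundary, are seen to be at most `π - δ`: the points lie in the cone at `p` spanned
by `q - p` and `p - r`. -/
theorem inner_ge_of_attached (hδ : 0 < δ) (hfat : M.IsFat δ) (hP : Convex ℝ P) (hQ : Convex ℝ Q)
    (ht : M.IsTriangle p q r) (hdisj : Disjoint (interior (convexHull ℝ {p, q, r})) P)
    (htQ : convexHull ℝ {p, q, r} ⊆ Q) (hpP : p ∈ P) (hqP : q ∈ P) (hpQ : p ∉ interior Q)
    {x : EPlane} (hxQ : x ∈ interior Q) (hx : x ∈ segment ℝ p q)
    (ha : a ∈ P ∩ Q) (hb : b ∈ P ∩ Q) :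
    -Real.cos δ * (‖a - p‖ * ‖b - p‖) ≤ inner ℝ (a - p) (b - p) := by
  have hsub := subset_convexHull ℝ ({p, q, r} : Set EPlane)
  -- `f` separates `P` from the triangle, `g` supports `Q` at `p`
  obtain ⟨f, s, hf, hfP⟩ := geometric_hahn_banach_open (convex_convexHull ℝ _).interior
    isOpen_interior hP hdisj
  have hfT : ∀ y ∈ convexHull ℝ ({p, q, r} : Set EPlane), f y ≤ s := by
    intro y hy
    have hcl : y ∈ closure (interior (convexHull ℝ ({p, q, r} : Set EPlane))) := by
      rw [(convex_convexHull ℝ _).closure_interior_eq_closure_of_nonempty_interior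
        ht.interior_nonempty]
      exact subset_closure hy
    exact closure_minimal (fun z hz => (hf z hz).le)
      (isClosed_le f.continuous continuous_const) hcl
  have hfp : f p = s := le_antisymm (hfT p (hsub (by simp))) (hfP p hpP)
  have hfq : f q = s := le_antisymm (hfT q (hsub (by simp))) (hfP q hqP)
  have hfr : f r < s := by
    obtain ⟨y, hy⟩ := ht.interior_nonempty
    obtain ⟨α, β, γ, hα, hβ, hγ, hsum, rfl⟩ := mem_convexHull_triple.mp (interior_subset hy)
    have := hf _ hy
    simp only [map_add, map_smul, smul_eq_mul, hfp, hfq] at this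
    by_contra! hle
    have hs : (α + β + γ) * s = s := by rw [hsum, one_mul]
    linarith [mul_le_mul_of_nonneg_left hle hγ]
  obtain ⟨g, hg, hgQ⟩ := exists_support hQ ⟨x, hxQ⟩ hpQ
  have hgq : g q < g p := by
    obtain ⟨α, β, hα, hβ, hsum, rfl⟩ := hx
    have := hg _ hxQ
    simp only [map_add, map_smul, smul_eq_mul] at this
    by_contra! hle
    have hs : (α + β) * g p = g p := by rw [hsum, one_mul]
    linarith [mul_le_mul_of_nonneg_left hle hβ]
  have hgr := hgQ r (htQ (hsub (by simp)))
  have hcross : cross (q - p) (r - p) ≠ 0 := by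
    rw [← abs_pos]
    refine lt_of_lt_of_le ?_ (sin_mul_le_abs_cross (ht.abs_inner_le hδ hfat))
    exact mul_pos (ht.sin_pos hδ hfat) (mul_pos (norm_pos_iff.mpr (sub_ne_zero.mpr ht.1.ne.symm))
      (norm_pos_iff.mpr (sub_ne_zero.mpr ht.2.2.1.ne.symm)))
  have cone : ∀ y ∈ P ∩ Q, ∃ σ τ : ℝ, 0 ≤ σ ∧ 0 ≤ τ ∧ y - p = σ • (q - p) + τ • (-(r - p)) := by
    rintro y ⟨hyP, hyQ⟩
    have hy := eq_combo_of_cross_ne_zero hcross (y - p)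
    generalize cross (y - p) (r - p) / cross (q - p) (r - p) = σ at hy
    generalize cross (q - p) (y - p) / cross (q - p) (r - p) = τ at hy
    have hfy := congrArg f hy
    have hgy := congrArg g hy
    simp only [map_add, map_smul, map_sub, smul_eq_mul] at hfy hgy
    have h1 := hfP y hyP
    have h2 := hgQ y hyQ
    have hτ : τ ≤ 0 := by
      by_contra! hτ
      rw [hfp, hfq] at hfy
      nlinarith [mul_pos hτ (sub_pos.mpr hfr)]
    have hσ : 0 ≤ σ := by
      by_contra! hσ
      nlinarith [mul_pos (neg_pos.mpr hσ) (sub_pos.mpr hgq),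
        mul_nonneg (neg_nonneg.mpr hτ) (sub_nonneg.mpr hgr)]
    exact ⟨σ, -τ, hσ, by linarith, by rw [hy]; module⟩
  obtain ⟨σ₁, τ₁, hσ₁, hτ₁, h₁⟩ := cone a ha
  obtain ⟨σ₂, τ₂, hσ₂, hτ₂, h₂⟩ := cone b hb
  rw [h₁, h₂]
  refine inner_cone_ge (by linarith [ht.half_le_cos hδ hfat]) ?_ hσ₁ hτ₁ hσ₂ hτ₂
  rw [norm_neg, inner_neg_right]
  linarith [(abs_le.mp (ht.abs_inner_le hδ hfat)).2]

/-! ### A carrot is determined by its two ends -/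

/-- `a` and `b` realise the largest distance between mesh vertices in `P`, in the form in which it
is used: no vertex in `P` is farther from `a` or from `b` than they are from each other. -/
def IsEndPair (M : PlaneStraightLineGraph) (P : Set EPlane) (a b : EPlane) : Prop :=
  a ∈ P ∧ b ∈ P ∧ ∀ v ∈ M.verts, v ∈ P → dist v a ≤ dist a b ∧ dist v b ≤ dist a b

/-- The closed triangles of the mesh in the disc of radius `R` around `z`. -/
def trianglesNear (M : PlaneStraightLineGraph) (z : EPlane) (R : ℝ) : Set (Set EPlane) :=
  {T | ∃ a b c, M.IsTriangle a b c ∧ T = convexHull ℝ {a, b, c} ∧ T ⊆ Metric.closedBall z R}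

/-- If two carrots have a common end pair, and each triangle of `Q` near the ends is in `P`, then
`Q` is contained in `P`. -/
theorem IsCarrot.subset_of_trianglesNear (hM : M.IsMesh) (hδ : 0 < δ) (hfat : M.IsFat δ)
    (hL0 : 0 < L) (hL : ∀ p q, M.graph.Adj p q → dist p q ≤ L) (hP : M.IsCarrot P)
    (hQ : M.IsCarrot Q) (hab : M.IsEndPair P a b) (haQ : a ∈ Q) (hbQ : b ∈ Q)
    (hPQ : (interior Q ∩ P).Nonempty)
    (hnear : ∀ T ∈ M.trianglesNear a (12 * L / Real.sin δ + L) ∪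
      M.trianglesNear b (12 * L / Real.sin δ + L), T ⊆ Q → T ⊆ P) : Q ⊆ P := by
  by_contra hne
  obtain ⟨p, q, r, ht, htQ, htP, hp, hq, x, hxQ, hx⟩ := exists_attached_triangle hM hP hQ hPQ hne
  have hpv := M.mem_verts ht.1
  have hball := ht.subset_closedBall hL
  have hfar : ∀ z, (convexHull ℝ {p, q, r} ∈ M.trianglesNear z (12 * L / Real.sin δ + L) →
      convexHull ℝ {p, q, r} ⊆ P) → 12 * L / Real.sin δ ≤ dist z p := by
    intro z hz
    by_contra! hlt
    refine htP (hz ⟨p, q, r, ht, rfl, hball.trans (Metric.closedBall_subset_closedBall' ?_)⟩)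
    rw [dist_comm] at hlt
    linarith
  have hdisj : Disjoint (interior (convexHull ℝ {p, q, r})) P := by
    rw [Set.disjoint_iff_inter_eq_empty, ← Set.not_nonempty_iff_eq_empty]
    exact fun h => htP (hP.isConvexPolygon.triangle_subset ht h)
  have h1 := hP.inner_lt_of_far hM hL0 hL (ht.sin_pos hδ hfat) (ht.half_le_cos hδ hfat)
    hab.1 hab.2.1 hp (hfar a fun h => hnear _ (Or.inl h) htQ)
    (hfar b fun h => hnear _ (Or.inr h) htQ) (hab.2.2 p hpv hp).1 (hab.2.2 p hpv hp).2
  have h2 := inner_ge_of_attached hδ hfat hP.convex hQ.convex ht hdisj htQ hp hq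
    (hQ.outerplanar p hpv) hxQ hx ⟨hab.1, haQ⟩ ⟨hab.2.1, hbQ⟩
  exact absurd h1 h2.not_gt

theorem IsCarrot.eq_of_trianglesNear_eq (hM : M.IsMesh) (hδ : 0 < δ) (hfat : M.IsFat δ)
    (hL0 : 0 < L) (hL : ∀ p q, M.graph.Adj p q → dist p q ≤ L) (hP : M.IsCarrot P)
    (hQ : M.IsCarrot Q) (hPab : M.IsEndPair P a b) (hQab : M.IsEndPair Q a b)
    (hnear : ∀ T ∈ M.trianglesNear a (12 * L / Real.sin δ + L) ∪
      M.trianglesNear b (12 * L / Real.sin δ + L), T ⊆ P ↔ T ⊆ Q) : P = Q := by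
  obtain ⟨u, v, w, ht, htP, haT⟩ := hP.isConvexPolygon.exists_triangle hM hPab.1
  have hsin := ht.sin_pos hδ hfat
  have hLR : L ≤ 12 * L / Real.sin δ := by
    rw [le_div_iff₀ hsin]
    nlinarith [Real.sin_le_one δ]
  have hball := ht.subset_closedBall hL
  have htQ : convexHull ℝ {u, v, w} ⊆ Q := by
    refine (hnear _ (Or.inl ⟨u, v, w, ht, rfl,
      hball.trans (Metric.closedBall_subset_closedBall' ?_)⟩)).mp htP
    have := hball haT
    rw [Metric.mem_closedBall, dist_comm] at this
    linarith
  obtain ⟨y, hy⟩ := ht.interior_nonempty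
  exact Set.Subset.antisymm
    (hQ.subset_of_trianglesNear hM hδ hfat hL0 hL hP hQab hPab.1 hPab.2.1
      ⟨y, interior_mono htP hy, htQ (interior_subset hy)⟩ fun T hT => (hnear T hT).mp)
    (hP.subset_of_trianglesNear hM hδ hfat hL0 hL hQ hPab hQab.1 hQab.2.1
      ⟨y, interior_mono htQ hy, htP (interior_subset hy)⟩ fun T hT => (hnear T hT).mpr)

theorem IsCarrot.exists_isEndPair (hM : M.IsMesh) (hP : M.IsCarrot P) :
    ∃ e ∈ M.verts ×ˢ M.verts, M.IsEndPair P e.1 e.2 := by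
  classical
  obtain ⟨x, hx⟩ := hP.nonempty_interior
  obtain ⟨u, v, w, ht, htP, -⟩ := hP.isConvexPolygon.exists_triangle hM (interior_subset hx)
  let V := M.verts.filter (· ∈ P)
  have hu : u ∈ V := Finset.mem_filter.mpr
    ⟨M.mem_verts ht.1, htP (subset_convexHull ℝ _ (by simp))⟩
  obtain ⟨⟨a, b⟩, hmem, hmax⟩ := (V ×ˢ V).exists_max_image (fun e => dist e.1 e.2)
    ⟨(u, u), Finset.mem_product.mpr ⟨hu, hu⟩⟩
  obtain ⟨ha, hb⟩ := Finset.mem_product.mp hmem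
  have ha' := Finset.mem_filter.mp ha
  have hb' := Finset.mem_filter.mp hb
  refine ⟨(a, b), Finset.mem_product.mpr ⟨ha'.1, hb'.1⟩, ha'.2, hb'.2, fun y hy hyP => ?_⟩
  have hyV : y ∈ V := Finset.mem_filter.mpr ⟨hy, hyP⟩
  exact ⟨hmax (y, a) (Finset.mem_product.mpr ⟨hyV, ha⟩),
    hmax (y, b) (Finset.mem_product.mpr ⟨hyV, hb⟩)⟩

/-! ### Counting -/

theorem trianglesNear_ncard_le (hM : M.IsMesh) (hδ : 0 < δ) (hfat : M.IsFat δ) {ℓ R : ℝ}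
    (hℓ : 0 < ℓ) (hedge : ∀ p q, M.graph.Adj p q → ℓ ≤ dist p q) {k : ℕ} (hsin : 0 < Real.sin δ)
    (hk : 2 * R / (Real.sin δ * ℓ / 6) ≤ k) (z : EPlane) :
    (M.trianglesNear z R).Finite ∧ (M.trianglesNear z R).ncard ≤ (2 * k + 1) ^ 2 := by
  refine ncard_le_of_disjoint_interior (z := z) (r := Real.sin δ * ℓ / 6)
    (by positivity) hk ?_ ?_ ?_
  · rintro T ⟨a, b, c, ht, rfl, -⟩
    exact ht.exists_ball_subset hδ hfat hℓ hedge
  · rintro T ⟨a, b, c, -, -, h⟩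
    exact h
  · rintro T ⟨a, b, c, ht, rfl, -⟩ T' ⟨a', b', c', ht', rfl, -⟩ hne
    exact hM.disjoint_interior _ _ _ _ _ _ ht ht' fun h => hne (by rw [h])

/-- Carrots with a given end pair inject into the sets of triangles near the ends. -/
theorem ncard_isEndPair_le (hM : M.IsMesh) (hδ : 0 < δ) (hfat : M.IsFat δ) (hL0 : 0 < L)
    (hL : ∀ p q, M.graph.Adj p q → dist p q ≤ L) {N : ℕ}
    (hN : ∀ z, (M.trianglesNear z (12 * L / Real.sin δ + L)).Finite ∧
      (M.trianglesNear z (12 * L / Real.sin δ + L)).ncard ≤ N) (a b : EPlane) :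
    {P | M.IsCarrot P ∧ M.IsEndPair P a b}.Finite ∧
      {P | M.IsCarrot P ∧ M.IsEndPair P a b}.ncard ≤ 2 ^ (N + N) := by
  set 𝒯 := M.trianglesNear a (12 * L / Real.sin δ + L) ∪
    M.trianglesNear b (12 * L / Real.sin δ + L)
  have hfin : 𝒯.Finite := (hN a).1.union (hN b).1
  let φ : Set EPlane → Set (Set EPlane) := fun P => {T ∈ 𝒯 | T ⊆ P}
  have hmaps : ∀ P ∈ {P | M.IsCarrot P ∧ M.IsEndPair P a b}, φ P ∈ 𝒫 𝒯 :=
    fun P _ => Set.sep_subset _ _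
  have hinj : Set.InjOn φ {P | M.IsCarrot P ∧ M.IsEndPair P a b} := by
    rintro P ⟨hP, hPab⟩ Q ⟨hQ, hQab⟩ heq
    refine hP.eq_of_trianglesNear_eq hM hδ hfat hL0 hL hQ hPab hQab fun T hT => ?_
    have : T ∈ φ P ↔ T ∈ φ Q := by rw [heq]
    exact ⟨fun h => (this.mp ⟨hT, h⟩).2, fun h => (this.mpr ⟨hT, h⟩).2⟩
  refine ⟨Set.Finite.of_injOn hmaps hinj hfin.powerset, ?_⟩
  refine (Set.ncard_le_ncard_of_injOn φ hmaps hinj hfin.powerset).trans ?_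
  rw [Set.ncard_powerset 𝒯 hfin]
  exact Nat.pow_le_pow_right two_pos
    ((Set.ncard_union_le _ _).trans (Nat.add_le_add (hN a).2 (hN b).2))

end PlaneStraightLineGraph

theorem mainTheorem7 (δ ρ : ℝ) (hδ : 0 < δ) :
    ∃ C : ℝ, ∀ M : PlaneStraightLineGraph, M.IsMesh → M.IsFat δ → M.HasEdgeRatio ρ →
      {P : Set EPlane | M.IsCarrot P}.Finite ∧
        ({P : Set EPlane | M.IsCarrot P}.ncard : ℝ) ≤ C * (M.size : ℝ) ^ 2 := by
  -- `k` bounds `2 R / r`, with `R = 12 L / sin δ + L` the radius of the discs around the ends and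
  -- `r = ℓ sin δ / 6` that of a disc in each triangle, where `L = ρ d` and `ℓ = d / ρ`
  let k : ℕ := ⌈2 * (12 / Real.sin δ + 1) * (6 * ρ ^ 2) / Real.sin δ⌉₊
  let N : ℕ := (2 * k + 1) ^ 2
  refine ⟨((2 ^ (N + N) : ℕ) : ℝ), fun M hM hfat hratio => ?_⟩
  rcases Set.eq_empty_or_nonempty {P : Set EPlane | M.IsCarrot P} with hemp | ⟨P₀, hP₀⟩
  · rw [hemp]
    exact ⟨Set.finite_empty, by rw [Set.ncard_empty, Nat.cast_zero]; positivity⟩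
  obtain ⟨x, hx⟩ := hP₀.nonempty_interior
  obtain ⟨u, v, w, ht, -, -⟩ := hP₀.isConvexPolygon.exists_triangle hM (interior_subset hx)
  have hsin := ht.sin_pos hδ hfat
  set d := dist u v
  have hd0 : 0 < d := dist_pos.mpr ht.1.ne
  have hρ : 0 < ρ := by
    by_contra! h
    have := hratio u v u v ht.1 ht.1
    nlinarith
  have hL : ∀ p q, M.graph.Adj p q → dist p q ≤ ρ * d := fun p q h => hratio p q u v h ht.1
  have hℓ : ∀ p q, M.graph.Adj p q → d / ρ ≤ dist p q := fun p q h => by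
    rw [div_le_iff₀' hρ]
    exact hratio u v p q ht.1 h
  have hk : 2 * (12 * (ρ * d) / Real.sin δ + ρ * d) / (Real.sin δ * (d / ρ) / 6) ≤ k := by
    refine le_trans (le_of_eq ?_) (Nat.le_ceil _)
    field_simp
  have hfiber := PlaneStraightLineGraph.ncard_isEndPair_le hM hδ hfat (mul_pos hρ hd0) hL
    (PlaneStraightLineGraph.trianglesNear_ncard_le hM hδ hfat (div_pos hd0 hρ) hℓ hsin hk)
  have hcover : {P : Set EPlane | M.IsCarrot P} ⊆
      ⋃ e ∈ M.verts ×ˢ M.verts, {P | M.IsCarrot P ∧ M.IsEndPair P e.1 e.2} := by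
    intro P hP
    obtain ⟨e, he, hend⟩ := hP.exists_isEndPair hM
    exact Set.mem_iUnion₂.mpr ⟨e, he, hP, hend⟩
  have hfin : (⋃ e ∈ M.verts ×ˢ M.verts,
      {P | M.IsCarrot P ∧ M.IsEndPair P e.1 e.2}).Finite :=
    (M.verts ×ˢ M.verts).finite_toSet.biUnion fun e _ => (hfiber e.1 e.2).1
  refine ⟨hfin.subset hcover, ?_⟩
  have hcard : {P : Set EPlane | M.IsCarrot P}.ncard ≤ 2 ^ (N + N) * M.size ^ 2 := by
    calc {P : Set EPlane | M.IsCarrot P}.ncard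
        ≤ (⋃ e ∈ M.verts ×ˢ M.verts, {P | M.IsCarrot P ∧ M.IsEndPair P e.1 e.2}).ncard :=
          Set.ncard_le_ncard hcover hfin
      _ ≤ ∑ e ∈ M.verts ×ˢ M.verts, {P | M.IsCarrot P ∧ M.IsEndPair P e.1 e.2}.ncard :=
          Finset.set_ncard_biUnion_le _ _
      _ ≤ ∑ _e ∈ M.verts ×ˢ M.verts, 2 ^ (N + N) :=
          Finset.sum_le_sum fun e _ => (hfiber e.1 e.2).2
      _ = 2 ^ (N + N) * M.size ^ 2 := by
          rw [Finset.sum_const, Finset.card_product, smul_eq_mul,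
            PlaneStraightLineGraph.size]; ring
  exact_mod_cast hcard
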